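/- All manifolds are smooth, finite-dimensional, Hausdorff, second countable and without boundary. For a manifold $N$ let $T^mN$ be the $m$-th tangent bundle ($m$-jets at $0$ of curves in $N$), let $\tau^m:T^mN\to N$ be its projection, and let $T^kT^lN$ be the iterated bundle, with elements $j^k_{s=0}j^l_{t=0}\gamma(s,t)$. Let $\iota^{k,l}:T^{k+l}N\to T^kT^lN$, $j^{k+l}c\mapsto j^k_{s=0}j^l_{t=0}c(s+t)$, be the canonical inclusion. For a smooth real vector bundle $\sigma:E\to M$ and $k\ge 0$, the bundle of semi-holonomic vectors $$\hat T^{k,k}E=\{X\in T^kT^kE:\ T^kT^k\sigma(X)\in\iota^{k,k}(T^{2k}M)\}$$ is a vector bundle over $T^{2k}M$, the pull-back of $T^kT^k\sigma$ along $\iota^{k,k}$. A vector bundle morphism $f:E_1\to E_2$ (over any smooth map of the bases) induces, by restriction of $T^kT^kf$, a morphism $\hat T^{k,k}f:\hat T^{k,k}E_1\to\hat T^{k,k}E_2$. For $0\le l\le k$ let $\tau^{(k)}_{(l),E}:\hat T^{k,k}E\to\hat T^{l,l}E$ be the map induced by the projection $T^kT^kE\to T^lT^lE$. Let $\Upsilon_{l,\sigma}:\hat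 T^{l,l}E\to E$ be the canonical vector bundle morphism over $\tau^{2l}:T^{2l}M\to M$ which is given, in coordinates $(x^a,y^i)$ on $E$ that are linear in the fibres, by $$\Upsilon_{l,\sigma}(\Phi)=\Bigl(x^a,\ \sum_{\alpha=0}^{l}(-1)^\alpha\binom l\alpha\, y^{i,(\alpha,l-\alpha)}(\Phi)\Bigr),\qquad y^{i,(\alpha,\beta)}\bigl(j^l_{s=0}j^l_{t=0}\gamma(s,t)\bigr)=\partial_s^\alpha\partial_t^\beta\big|_{s=t=0}\,y^i(\gamma(s,t)).$$ **Lemma (Universality of $\Upsilon_{k,\sigma}$).** Let $k\ge 0$ and let $F=\{(F_E,\underline{F_E})\}$ be a functorial vector bundle morphism from semi-holonomic vectors to $E$. That is, for every vector bundle $\sigma:E\to M$, the map $F_E:\hat T^{k,k}E\to E$ is a vector bundle morphism covering $\underline{F_E}:T^{2k}M\to M$, and $F_{E_2}\circ\hat T^{k,k}f=f\circ F_{E_1}$ for every vector bundle morphism $f:E_1\to E_2$. Then: 1. $\underline{F_E}=\tau^{2k}$ for every vector bundle $E$ over a connected manifold $M$; 2. there are real constants $a_0,\dots,a_k$, which depend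 only on $F$, such that for every vector bundle $\sigma:E\to M$ over a connected manifold $M$ $$F_E=\sum_{l=0}^{k}a_l\;\Upsilon_{l,\sigma}\circ\tau^{(k)}_{(l),E}.$$ -/

import Mathlib

open scoped Manifold ContDiff Topology
open Bundle Set Filter

noncomputable section

/-! ## Higher and iterated higher tangent bundles -/

namespace HigherTangent

/-- `∂_s^α ∂_t^β h (s, t)` at `(s, t) = (0, 0)`. -/
def mixedDeriv {V : Type*} [NormedAddCommGroup V] [NormedSpace ℝ V] (α β : ℕ) (h : ℝ × ℝ → V) : V :=
  iteratedDeriv α (fun s => iteratedDeriv β (fun t => h (s, t)) 0) 0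

section Velocities

variable {EN HN : Type*} [NormedAddCommGroup EN] [NormedSpace ℝ EN] [TopologicalSpace HN]
  (I : ModelWithCorners ℝ EN HN) (N : Type*) [TopologicalSpace N] [ChartedSpace HN N]
  {EP HP : Type*} [NormedAddCommGroup EP] [NormedSpace ℝ EP] [TopologicalSpace HP]
  {J : ModelWithCorners ℝ EP HP} {P : Type*} [TopologicalSpace P] [ChartedSpace HP P]

/-- Smooth curves in `N`. -/
abbrev Curve := C^∞⟮𝓘(ℝ, ℝ), ℝ; I, N⟯

/-- Smooth two-parameter families `(s, t) ↦ γ (s, t)` of points of `N`. -/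
abbrev Surface := C^∞⟮𝓘(ℝ, ℝ × ℝ), ℝ × ℝ; I, N⟯

/-- Two curves have the same `m`-jet at `0`: all lifts `f^{(r)}`, `r ≤ m`, of all smooth functions
`f` on `N` agree. -/
def curveSetoid (m : ℕ) : Setoid (Curve I N) where
  r c c' := c 0 = c' 0 ∧ ∀ f : C^∞⟮I, N; 𝓘(ℝ, ℝ), ℝ⟯, ∀ r ≤ m,
    iteratedDeriv r (fun t => f (c t)) 0 = iteratedDeriv r (fun t => f (c' t)) 0
  iseqv :=
    { refl := fun _ => ⟨rfl, fun _ _ _ => rfl⟩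
      symm := fun h => ⟨h.1.symm, fun f r hr => (h.2 f r hr).symm⟩
      trans := fun h h' => ⟨h.1.trans h'.1, fun f r hr => (h.2 f r hr).trans (h'.2 f r hr)⟩ }

/-- Two maps `(s, t) ↦ γ (s, t)` define the same element `j^k_{s = 0} j^l_{t = 0} γ (s, t)` of
`T^k T^l N`: all lifts `f^{(α, β)} = (f^{(β)})^{(α)}`, `α ≤ k`, `β ≤ l`, of all smooth functions `f`
on `N` agree. -/
def surfaceSetoid (k l : ℕ) : Setoid (Surface I N) where
  r γ γ' := γ 0 = γ' 0 ∧ ∀ f : C^∞⟮I, N; 𝓘(ℝ, ℝ), ℝ⟯, ∀ α ≤ k, ∀ β ≤ l,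
    mixedDeriv α β (fun p => f (γ p)) = mixedDeriv α β (fun p => f (γ' p))
  iseqv :=
    { refl := fun _ => ⟨rfl, fun _ _ _ _ _ => rfl⟩
      symm := fun h => ⟨h.1.symm, fun f α hα β hβ => (h.2 f α hα β hβ).symm⟩
      trans := fun h h' =>
        ⟨h.1.trans h'.1, fun f α hα β hβ => (h.2 f α hα β hβ).trans (h'.2 f α hα β hβ)⟩ }

/-- The `m`-th tangent bundle `T^m N`: the `m`-jets at `0` of smooth curves in `N`. -/
def TT (m : ℕ) := Quotient (curveSetoid I N m)

/-- The iterated higher tangent bundle `T^k T^l N`, the set of `(k, l)`-velocities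
`j^k_{s = 0} j^l_{t = 0} γ (s, t)`. -/
def TT2 (k l : ℕ) := Quotient (surfaceSetoid I N k l)

variable {I N}

/-- The `m`-jet at `0` of the curve `c`. -/
def TT.mk (m : ℕ) (c : Curve I N) : TT I N m := Quotient.mk (curveSetoid I N m) c

/-- The velocity `j^k_{s = 0} j^l_{t = 0} γ (s, t)`. -/
def TT2.mk (k l : ℕ) (γ : Surface I N) : TT2 I N k l := Quotient.mk (surfaceSetoid I N k l) γ

/-- The projection `τ^m : T^m N → N`. -/
def TT.proj {m : ℕ} : TT I N m → N :=
  Quotient.lift (fun c : Curve I N => c 0) fun _ _ h => h.1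

/-- The projection `τ^m_{m'} : T^m N → T^{m'} N`. -/
def TT.truncate {m m' : ℕ} (h : m' ≤ m) : TT I N m → TT I N m' :=
  Quotient.map' id fun _ _ hc => ⟨hc.1, fun f r hr => hc.2 f r (hr.trans h)⟩

/-- The projection `τ^{(k, l)}_{(k', l')} : T^k T^l N → T^{k'} T^{l'} N`. -/
def TT2.truncate {k l k' l' : ℕ} (hk : k' ≤ k) (hl : l' ≤ l) : TT2 I N k l → TT2 I N k' l' :=
  Quotient.map' id fun _ _ hc =>
    ⟨hc.1, fun f α hα β hβ => hc.2 f α (hα.trans hk) β (hβ.trans hl)⟩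

/-- The map `T^m φ : T^m N → T^m P` induced by a smooth map `φ : N → P`. -/
def TT.map {m : ℕ} (φ : C^∞⟮I, N; J, P⟯) : TT I N m → TT J P m :=
  Quotient.map' (fun c => φ.comp c) fun _ _ h =>
    ⟨congrArg φ h.1, fun f r hr => h.2 (f.comp φ) r hr⟩

/-- The map `T^k T^l φ : T^k T^l N → T^k T^l P` induced by a smooth map `φ : N → P`. -/
def TT2.map {k l : ℕ} (φ : C^∞⟮I, N; J, P⟯) : TT2 I N k l → TT2 J P k l :=
  Quotient.map' (fun γ => φ.comp γ) fun _ _ h =>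
    ⟨congrArg φ h.1, fun f α hα β hβ => h.2 (f.comp φ) α hα β hβ⟩

/-- The smooth map `(s, t) ↦ s + t`. -/
def addMap : C^∞⟮𝓘(ℝ, ℝ × ℝ), ℝ × ℝ; 𝓘(ℝ, ℝ), ℝ⟯ :=
  ⟨fun p => p.1 + p.2, (contDiff_fst.add contDiff_snd).contMDiff⟩

theorem mixedDeriv_comp_add (α β : ℕ) (g : ℝ → ℝ) :
    mixedDeriv α β (fun p => g (p.1 + p.2)) = iteratedDeriv (α + β) g 0 := by
  have h : (fun s : ℝ => iteratedDeriv β (fun t => g (s + t)) 0) = iteratedDeriv β g := by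
    funext s
    rw [iteratedDeriv_comp_const_add]
    simp
  simp only [mixedDeriv]
  rw [h, iteratedDeriv_eq_iterate, iteratedDeriv_eq_iterate, iteratedDeriv_eq_iterate,
    Function.iterate_add_apply]

/-- The canonical inclusion `ι^{k, l} : T^{k + l} N → T^k T^l N`, which sends `j^{k + l} c` to
`j^k_{s = 0} j^l_{t = 0} c (s + t)`. -/
def TT.iota (k l : ℕ) : TT I N (k + l) → TT2 I N k l :=
  Quotient.map' (fun c => c.comp addMap) fun c c' h => by
    refine ⟨?_, fun f α hα β hβ => ?_⟩
    · have e : addMap (0 : ℝ × ℝ) = 0 := add_zero (0 : ℝ)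
      change c (addMap 0) = c' (addMap 0)
      rw [e]
      exact h.1
    · have e := h.2 f (α + β) (add_le_add hα hβ)
      rw [← mixedDeriv_comp_add α β, ← mixedDeriv_comp_add α β] at e
      exact e

theorem TT.iota_map (k l : ℕ) (φ : C^∞⟮I, N; J, P⟯) (v : TT I N (k + l)) :
    TT.iota k l (TT.map φ v) = TT2.map φ (TT.iota k l v) := by
  induction v using Quotient.inductionOn
  rfl

theorem TT.iota_truncate {k l k' l' : ℕ} (hk : k' ≤ k) (hl : l' ≤ l) (v : TT I N (k + l)) :
    TT.iota k' l' (TT.truncate (add_le_add hk hl) v) = TT2.truncate hk hl (TT.iota k l v) := by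
  induction v using Quotient.inductionOn
  rfl

theorem TT2.map_truncate {k l k' l' : ℕ} (hk : k' ≤ k) (hl : l' ≤ l) (φ : C^∞⟮I, N; J, P⟯)
    (X : TT2 I N k l) :
    TT2.map φ (TT2.truncate hk hl X) = TT2.truncate hk hl (TT2.map φ X) := by
  induction X using Quotient.inductionOn
  rfl

end Velocities

/-! ## Smooth vector bundles and their morphisms -/

/-- A smooth real vector bundle `σ : E → M` of finite rank, with typical fibre `F`, over a smooth
`n`-dimensional manifold `M` without boundary (Hausdorff and second countable, possibly
disconnected). -/
structure VB where
  n : ℕ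
  M : Type
  [topM : TopologicalSpace M]
  [chartedM : ChartedSpace (EuclideanSpace ℝ (Fin n)) M]
  [manifoldM : IsManifold (𝓡 n) ∞ M]
  [t2M : T2Space M]
  [secondCountableM : SecondCountableTopology M]
  F : Type
  [groupF : NormedAddCommGroup F]
  [spaceF : NormedSpace ℝ F]
  [finiteF : FiniteDimensional ℝ F]
  fiber : M → Type
  [groupFiber : ∀ x, AddCommGroup (fiber x)]
  [moduleFiber : ∀ x, Module ℝ (fiber x)]
  [topFiber : ∀ x, TopologicalSpace (fiber x)]
  [topTotal : TopologicalSpace (TotalSpace F fiber)]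
  [fiberBundle : FiberBundle F fiber]
  [vectorBundle : VectorBundle ℝ F fiber]
  [smoothBundle : ContMDiffVectorBundle ∞ F fiber (𝓡 n)]

namespace VB

attribute [instance] topM chartedM manifoldM t2M secondCountableM groupF spaceF finiteF groupFiber
  moduleFiber topFiber topTotal fiberBundle vectorBundle smoothBundle

/-- The total space of the bundle. -/
abbrev Total (E : VB) : Type := TotalSpace E.F E.fiber

/-- The model with corners of the total space. -/
abbrev model (E : VB) := (𝓡 E.n).prod 𝓘(ℝ, E.F)

/-- The bundle projection `σ : E → M`. -/
def sigma (E : VB) : C^∞⟮E.model, E.Total; 𝓡 E.n, E.M⟯ := ⟨fun e => e.proj, contMDiff_proj E.fiber⟩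

/-- `c = a + b` in one fibre of `E`: the graph of the addition `E ×_M E → E`. -/
def IsSum {E : VB} (a b c : E.Total) : Prop :=
  ∃ (x : E.M) (u v : E.fiber x), a = ⟨x, u⟩ ∧ b = ⟨x, v⟩ ∧ c = ⟨x, u + v⟩

/-- `b = r • a` in one fibre of `E`: the graph of the multiplication by `r`. -/
def IsSMul {E : VB} (r : ℝ) (a b : E.Total) : Prop :=
  ∃ (x : E.M) (u : E.fiber x), a = ⟨x, u⟩ ∧ b = ⟨x, r • u⟩

end VB

/-- A morphism of vector bundles `E₁ → E₂`, over a smooth map of the bases that may be any. -/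
structure VBHom (E₁ E₂ : VB) where
  base : C^∞⟮𝓡 E₁.n, E₁.M; 𝓡 E₂.n, E₂.M⟯
  onFiber : ∀ x : E₁.M, E₁.fiber x →ₗ[ℝ] E₂.fiber (base x)
  smooth : ContMDiff E₁.model E₂.model ∞
    (fun e : E₁.Total => (⟨base e.proj, onFiber e.proj e.2⟩ : E₂.Total))

/-- The smooth map of total spaces given by a morphism of vector bundles. -/
def VBHom.total {E₁ E₂ : VB} (f : VBHom E₁ E₂) : C^∞⟮E₁.model, E₁.Total; E₂.model, E₂.Total⟯ :=
  ⟨fun e => ⟨f.base e.proj, f.onFiber e.proj e.2⟩, f.smooth⟩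

/-! ## Semi-holonomic vectors -/

/-- The bundle of semi-holonomic vectors of order `(k, k)`, that is, the pull-back of
`T^k T^k σ : T^k T^k E → T^k T^k M` along `ι^{k, k} : T^{2k} M → T^k T^k M`. An element is a pair
`(v, X)` of a `2k`-velocity `v` of `M` and of `X ∈ T^k T^k E` which projects to `ι^{k, k} (v)`. -/
def SemiHol (k : ℕ) (E : VB) : Type :=
  {p : TT (𝓡 E.n) E.M (k + k) × TT2 E.model E.Total k k //
    TT2.map E.sigma p.2 = TT.iota k k p.1}

namespace SemiHol

variable {k : ℕ} {E : VB}

/-- The projection of the bundle of semi-holonomic vectors to its base `T^{2k} M`. -/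
def base (Φ : SemiHol k E) : TT (𝓡 E.n) E.M (k + k) := Φ.1.1

/-- The inclusion of the bundle of semi-holonomic vectors into `T^k T^k E`. -/
def vec (Φ : SemiHol k E) : TT2 E.model E.Total k k := Φ.1.2

/-- The restriction of `T^k T^k f` to semi-holonomic vectors, for a morphism `f`. -/
def map {E₁ E₂ : VB} (f : VBHom E₁ E₂) (Φ : SemiHol k E₁) : SemiHol k E₂ :=
  ⟨(TT.map f.base Φ.base, TT2.map f.total Φ.vec), by
    obtain ⟨⟨v, X⟩, h⟩ := Φ
    change TT2.map E₂.sigma (TT2.map f.total X) = TT.iota k k (TT.map f.base v)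
    change TT2.map E₁.sigma X = TT.iota k k v at h
    rw [TT.iota_map, ← h]
    induction X using Quotient.inductionOn
    rfl⟩

/-- The projection `τ^{(k)}_{(l), E}` from semi-holonomic vectors of order `(k, k)` to those of order
`(l, l)`, induced by `τ^{(k, k)}_{(l, l), E} : T^k T^k E → T^l T^l E`. -/
def truncate {l : ℕ} (h : l ≤ k) (Φ : SemiHol k E) : SemiHol l E :=
  ⟨(TT.truncate (add_le_add h h) Φ.base, TT2.truncate h h Φ.vec), by
    obtain ⟨⟨v, X⟩, hΦ⟩ := Φ
    change TT2.map E.sigma (TT2.truncate h h X) = TT.iota l l (TT.truncate (add_le_add h h) v)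
    change TT2.map E.sigma X = TT.iota k k v at hΦ
    rw [TT.iota_truncate, TT2.map_truncate, hΦ]⟩

/-- Addition in the fibres of the bundle of semi-holonomic vectors over `T^{2k} M`, as a relation.
It is the restriction of the addition of the vector bundle `T^k T^k σ`, which is `T^k T^k` of the
addition `E ×_M E → E`: jets of maps with a common projection to `M` are added pointwise. -/
def IsSum (Φ₁ Φ₂ Φ₃ : SemiHol k E) : Prop :=
  Φ₁.base = Φ₃.base ∧ Φ₂.base = Φ₃.base ∧
    ∃ γ₁ γ₂ γ₃ : Surface E.model E.Total, (∀ p, VB.IsSum (γ₁ p) (γ₂ p) (γ₃ p)) ∧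
      Φ₁.vec = TT2.mk k k γ₁ ∧ Φ₂.vec = TT2.mk k k γ₂ ∧ Φ₃.vec = TT2.mk k k γ₃

/-- Multiplication by `r` in the fibres of the bundle of semi-holonomic vectors over `T^{2k} M`, as a
relation. -/
def IsSMul (r : ℝ) (Φ₁ Φ₂ : SemiHol k E) : Prop :=
  Φ₁.base = Φ₂.base ∧
    ∃ γ₁ γ₂ : Surface E.model E.Total, (∀ p, VB.IsSMul r (γ₁ p) (γ₂ p)) ∧
      Φ₁.vec = TT2.mk k k γ₁ ∧ Φ₂.vec = TT2.mk k k γ₂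

/-- The space of adapted coordinates `(x^{(r)}, y^{(α, β)})`, `r ≤ 2k`, `α, β ≤ k`, on the bundle of
semi-holonomic vectors. -/
abbrev CoordSpace (k : ℕ) (E : VB) : Type :=
  (Fin (k + k + 1) → EuclideanSpace ℝ (Fin E.n)) × (Fin (k + 1) → Fin (k + 1) → E.F)

/-- The adapted coordinates of the semi-holonomic vector represented by the curve `c` in `M` and the
map `γ` to `E`, in the preferred chart of `M` and the preferred trivialization of `E` at `x₀`. -/
def coords (k : ℕ) (x₀ : E.M) (c : Curve (𝓡 E.n) E.M) (γ : Surface E.model E.Total) :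
    CoordSpace k E :=
  (fun r => iteratedDeriv r (fun t => extChartAt (𝓡 E.n) x₀ (c t)) 0,
   fun α β => mixedDeriv α β (fun p => (trivializationAt E.F E.fiber x₀ (γ p)).2))

/-- The (open) range of the adapted coordinates. -/
def coordDomain (k : ℕ) (x₀ : E.M) : Set (CoordSpace k E) :=
  {ξ | ξ.1 0 ∈ (extChartAt (𝓡 E.n) x₀).target ∧
    (extChartAt (𝓡 E.n) x₀).symm (ξ.1 0) ∈ (trivializationAt E.F E.fiber x₀).baseSet}

/-- Smoothness of a map from the bundle of semi-holonomic vectors to `E`: near every point of `M`, the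
map is a smooth function of the adapted coordinates. -/
def IsSmooth (G : SemiHol k E → E.Total) : Prop :=
  ∀ x₀ : E.M, ∃ g : CoordSpace k E → E.Total,
    ContMDiffOn 𝓘(ℝ, CoordSpace k E) E.model ∞ g (coordDomain k x₀) ∧
    ∀ (Φ : SemiHol k E) (c : Curve (𝓡 E.n) E.M) (γ : Surface E.model E.Total),
      Φ.base = TT.mk (k + k) c → Φ.vec = TT2.mk k k γ →
      c 0 ∈ (extChartAt (𝓡 E.n) x₀).source → c 0 ∈ (trivializationAt E.F E.fiber x₀).baseSet →
      G Φ = g (coords k x₀ c γ)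

/-- `(G, b)` is a morphism of vector bundles from the bundle of semi-holonomic vectors over `T^{2k} M`
to `E` over `M`: the map `G` covers `b`, is linear on the fibres, and is smooth. -/
structure IsMorphism (G : SemiHol k E → E.Total) (b : TT (𝓡 E.n) E.M (k + k) → E.M) : Prop where
  covers : ∀ Φ, (G Φ).proj = b Φ.base
  add : ∀ Φ₁ Φ₂ Φ₃, IsSum Φ₁ Φ₂ Φ₃ → VB.IsSum (G Φ₁) (G Φ₂) (G Φ₃)
  smul : ∀ (r : ℝ) Φ₁ Φ₂, IsSMul r Φ₁ Φ₂ → VB.IsSMul r (G Φ₁) (G Φ₂)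
  smooth : IsSmooth G

end SemiHol

/-! ## The morphisms `Υ_l` -/

section Upsilon

variable {V : Type*} [NormedAddCommGroup V] [NormedSpace ℝ V]

theorem mixedDeriv_congr (α β : ℕ) {h h' : ℝ × ℝ → V} (e : h =ᶠ[𝓝 0] h') :
    mixedDeriv α β h = mixedDeriv α β h' := by
  refine Filter.EventuallyEq.iteratedDeriv_eq α ?_
  have e' : ∀ᶠ p in 𝓝 ((0 : ℝ), (0 : ℝ)), h p = h' p := e
  rw [nhds_prod_eq] at e'
  filter_upwards [e'.curry] with s hs
  exact Filter.EventuallyEq.iteratedDeriv_eq β hs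

theorem iteratedDeriv_clm_comp {W : Type*} [NormedAddCommGroup W] [NormedSpace ℝ W] (m : ℕ)
    (φ : V →L[ℝ] W) {g : ℝ → V} (hg : ContDiff ℝ ∞ g) (t : ℝ) :
    iteratedDeriv m (fun u => φ (g u)) t = φ (iteratedDeriv m g t) := by
  have := φ.iteratedFDeriv_comp_left (x := t) (i := m) (n := ∞) hg.contDiffAt (by exact_mod_cast le_top)
  simp only [iteratedDeriv]
  change iteratedFDeriv ℝ m (φ ∘ g) t _ = _
  rw [this]
  rfl

theorem contDiff_iteratedDeriv_snd (β : ℕ) {h : ℝ × ℝ → V} (hh : ContDiff ℝ ∞ h) :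
    ContDiff ℝ ∞ (fun p : ℝ × ℝ => iteratedDeriv β (fun t => h (p.1, t)) p.2) := by
  induction β with
  | zero => simpa using hh
  | succ β ih =>
    set G : ℝ × ℝ → V := fun p => iteratedDeriv β (fun t => h (p.1, t)) p.2 with hG
    have e : (fun p : ℝ × ℝ => iteratedDeriv (β + 1) (fun t => h (p.1, t)) p.2) =
        fun p => fderiv ℝ G p (0, 1) := by
      funext p
      rw [iteratedDeriv_succ]
      have h1 : HasFDerivAt G (fderiv ℝ G p) (p.1, p.2) :=
        (ih.differentiable (by simp) p).hasFDerivAt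
      have h2 : HasDerivAt (fun t : ℝ => (p.1, t)) ((0 : ℝ), (1 : ℝ)) p.2 :=
        (hasDerivAt_const p.2 p.1).prodMk (hasDerivAt_id p.2)
      exact (h1.comp_hasDerivAt p.2 h2).deriv
    rw [e]
    exact (ih.fderiv_right (m := ∞) (by simp)).clm_apply contDiff_const

theorem mixedDeriv_clm_comp {W : Type*} [NormedAddCommGroup W] [NormedSpace ℝ W] (α β : ℕ)
    (φ : V →L[ℝ] W) {h : ℝ × ℝ → V} (hh : ContDiff ℝ ∞ h) :
    mixedDeriv α β (fun p => φ (h p)) = φ (mixedDeriv α β h) := by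
  have h1 : (fun s => iteratedDeriv β (fun t => φ (h (s, t))) 0) =
      fun s => φ (iteratedDeriv β (fun t => h (s, t)) 0) := by
    funext s
    exact iteratedDeriv_clm_comp β φ (hh.comp (contDiff_prodMk_right s)) 0
  simp only [mixedDeriv]
  rw [h1]
  exact iteratedDeriv_clm_comp α φ
    ((contDiff_iteratedDeriv_snd β hh).comp (contDiff_prodMk_left (0 : ℝ))) 0

variable {E : VB}

/-- The fibre coordinate of the preferred trivialization at `x` extends, from a neighbourhood of `x`,
to a smooth map on the total space. -/
theorem exists_fiberCoord_extension (E : VB) (x : E.M) :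
    ∃ y : C^∞⟮E.model, E.Total; 𝓘(ℝ, E.F), E.F⟯, ∀ᶠ x' in 𝓝 x, ∀ e : E.Total, e.proj = x' →
      y e = (trivializationAt E.F E.fiber x e).2 := by
  set T := trivializationAt E.F E.fiber x with hT
  have hx : T.baseSet ∈ 𝓝 x :=
    T.open_baseSet.mem_nhds (FiberBundle.mem_baseSet_trivializationAt' x)
  obtain ⟨χ, -, hχ⟩ := (SmoothBumpFunction.nhds_basis_tsupport (I := 𝓡 E.n) x).mem_iff.1 hx
  refine ⟨⟨fun e => χ e.proj • (T e).2, ?_⟩, ?_⟩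
  · intro e
    by_cases he : e.proj ∈ T.baseSet
    · have h1 : ContMDiffAt E.model (𝓡 E.n) ∞ (fun e : E.Total => e.proj) e :=
        (contMDiff_proj E.fiber) e
      have h2 : ContMDiffAt E.model 𝓘(ℝ, ℝ) ∞ (fun e : E.Total => χ e.proj) e :=
        (χ.contMDiff e.proj).comp e h1
      have h3 : ContMDiffAt E.model ((𝓡 E.n).prod 𝓘(ℝ, E.F)) ∞ T e :=
        (T.contMDiffOn (IB := 𝓡 E.n) (n := ∞)).contMDiffAt
          (T.open_source.mem_nhds (T.mem_source.2 he))
      exact h2.smul h3.snd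
    · have h0 : (fun e : E.Total => χ e.proj • (T e).2) =ᶠ[𝓝 e] fun _ => 0 := by
        have hc : e.proj ∉ tsupport χ := fun h => he (hχ h)
        have hn : ∀ᶠ e' in 𝓝 e, e'.proj ∉ tsupport χ :=
          (FiberBundle.continuous_proj E.F E.fiber).continuousAt.eventually
            ((isClosed_tsupport χ).isOpen_compl.mem_nhds hc)
        filter_upwards [hn] with e' he'
        rw [image_eq_zero_of_notMem_tsupport he', zero_smul]
      exact contMDiffAt_const.congr_of_eventuallyEq h0
  · filter_upwards [χ.eventuallyEq_one] with x' hx' e he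
    subst he
    change χ e.proj • (T e).2 = (T e).2
    rw [hx']
    exact one_smul ℝ _

/-- The coordinate `y^{(α, β)}` of the velocity of `γ`, in the preferred trivialization of `E` at the
base point of the velocity. -/
def fiberCoord (α β : ℕ) (γ : Surface E.model E.Total) : E.F :=
  mixedDeriv α β (fun p => (trivializationAt E.F E.fiber (γ 0).proj (γ p)).2)

theorem fiberCoord_congr {k l α β : ℕ} (hα : α ≤ k) (hβ : β ≤ l) {γ γ' : Surface E.model E.Total}
    (h : surfaceSetoid E.model E.Total k l γ γ') : fiberCoord α β γ = fiberCoord α β γ' := by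
  obtain ⟨y, hy⟩ := exists_fiberCoord_extension E (γ 0).proj
  have key : ∀ δ : Surface E.model E.Total, δ 0 = γ 0 →
      mixedDeriv α β (fun p => (trivializationAt E.F E.fiber (γ 0).proj (δ p)).2) =
        mixedDeriv α β (fun p => y (δ p)) := by
    intro δ hδ
    refine mixedDeriv_congr α β ?_
    have hc : ContinuousAt (fun p => (δ p).proj) 0 :=
      ((FiberBundle.continuous_proj E.F E.fiber).comp δ.contMDiff.continuous).continuousAt
    have hy' : ∀ᶠ x' in 𝓝 (δ 0).proj, ∀ e : E.Total, e.proj = x' →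
      y e = (trivializationAt E.F E.fiber (γ 0).proj e).2 := by rw [hδ]; exact hy
    filter_upwards [hc.eventually hy'] with p hp
    exact (hp _ rfl).symm
  have smooth : ∀ δ : Surface E.model E.Total, ContDiff ℝ ∞ (fun p => y (δ p)) := fun δ =>
    contMDiff_iff_contDiff.1 (y.contMDiff.comp δ.contMDiff)
  have e1 : fiberCoord α β γ = mixedDeriv α β (fun p => y (γ p)) := key γ rfl
  have e2 : fiberCoord α β γ' = mixedDeriv α β (fun p => y (γ' p)) := by
    rw [fiberCoord, ← h.1]
    exact key γ' h.1.symm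
  rw [e1, e2, SeparatingDual.eq_iff_forall_dual_eq (R := ℝ)]
  intro φ
  rw [← mixedDeriv_clm_comp α β φ (smooth γ), ← mixedDeriv_clm_comp α β φ (smooth γ')]
  exact h.2 ⟨fun e => φ (y e), φ.contMDiff.comp y.contMDiff⟩ α hα β hβ

/-- The element of `E` over the base point of the velocity of `γ` whose fibre coordinate is
`∑_{α ≤ l} (-1)^α (l choose α) y^{(α, l - α)}`. -/
def upsilonAux (l : ℕ) (γ : Surface E.model E.Total) : E.Total :=
  ⟨(γ 0).proj, (trivializationAt E.F E.fiber (γ 0).proj).symm (γ 0).proj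
    (∑ α ∈ Finset.range (l + 1), ((-1 : ℝ) ^ α * (l.choose α : ℝ)) • fiberCoord α (l - α) γ)⟩

theorem upsilonAux_congr {l : ℕ} {γ γ' : Surface E.model E.Total}
    (h : surfaceSetoid E.model E.Total l l γ γ') : upsilonAux l γ = upsilonAux l γ' := by
  have e : ∑ α ∈ Finset.range (l + 1), ((-1 : ℝ) ^ α * (l.choose α : ℝ)) • fiberCoord α (l - α) γ =
      ∑ α ∈ Finset.range (l + 1), ((-1 : ℝ) ^ α * (l.choose α : ℝ)) • fiberCoord α (l - α) γ' :=
    Finset.sum_congr rfl fun α hα => by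
      rw [fiberCoord_congr (Nat.lt_succ_iff.1 (Finset.mem_range.1 hα)) (Nat.sub_le l α) h]
  rw [upsilonAux, upsilonAux, e, h.1]

/-- The morphism `Υ_{l, σ}` from semi-holonomic vectors of order `(l, l)` to `E`, over
`τ^{2l} : T^{2l} M → M`. In linear fibre coordinates it is
`y = ∑_{α = 0}^{l} (-1)^α (l choose α) y^{(α, l - α)}`. This is the coordinate form of the formula
`⟨Υ(Φ), ξ⟩ = ⟨∑_j (-1)^j (l choose j) Φ^{(j, l - j)}, j^l ξ⟩`, the pairing being the lift of the pairing
of `E` with its dual, and its value does not depend on the coordinates. -/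
def upsilon (l : ℕ) (Φ : SemiHol l E) : E.Total :=
  Quotient.lift (s := surfaceSetoid E.model E.Total l l) (upsilonAux l)
    (fun _ _ h => upsilonAux_congr h) Φ.vec

end Upsilon

end HigherTangent

end

/-! A semi-holonomic vector projects to the jet of $c(s+t)$ for a curve $c$. After shrinking $c$
into a trivializing chart, the vector is therefore the image of one over the real line, represented
by $(s,t)\mapsto(s+t,g(s,t))$ in a trivial bundle, under the morphism over $c$ given by the
trivialization (`SemiHol.exists_eq_map_lineVector`). By functoriality, $F$ is determined by its
values on these vectors.

The base map: zero morphisms over curves give $\underline{F_E}(j^{2k}c)=c(r)$ with one universal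
$r$. Since $c(r)$ depends only on the jet of $c$ at $0$, locality forces $r=0$
(`IsFunctorial.base_eq_proj`).

The fibre part: postcomposition with linear functionals reduces to scalar $g$, and only the Taylor
coefficients of $g$ of order at most $(k,k)$ matter, so it suffices to know the value $m_{i,j}$ on
$s^it^j$. Multiplication by the coordinate $x$ of the line is a bundle endomorphism. It sends $g$ to
$(s+t)g$ and is zero on the fibre over $0$, where $F$ takes its values. So $F$ kills $(s+t)g$
(`lineValue_add_mul`), which gives $m_{i+1,j}=-m_{i,j+1}$ and $m_{i,j}=(-1)^im_{0,i+j}$. Moreover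
$m_{0,l}=0$ for $l>k$, because $t^l$ then has zero $(k,k)$-velocity. Grouping the Taylor sum by
$l=i+j$ turns the factorials into binomial coefficients and produces the $\Upsilon_l$ with
$a_l=m_{0,l}/l!$ (`lineValue_eq`). -/

noncomputable section

namespace HigherTangent

/-! ### Calculus of mixed derivatives at the origin -/

section MixedDeriv

variable {V W U : Type*} [NormedAddCommGroup V] [NormedSpace ℝ V] [NormedAddCommGroup W]
  [NormedSpace ℝ W] [NormedAddCommGroup U] [NormedSpace ℝ U]

theorem contDiff_iteratedDeriv_of_contDiff (m : ℕ) {g : ℝ → V} (hg : ContDiff ℝ ∞ g) :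
    ContDiff ℝ ∞ (iteratedDeriv m g) := by
  rw [iteratedDeriv_eq_iterate]
  exact ContDiff.iterate_deriv m hg

/-- The `m`-th derivative of `H ∘ q` is a universal smooth function of the derivatives of `q` of
order at most `m`. -/
theorem exists_contDiff_iteratedDeriv_comp (m : ℕ) {H : W → U} (hH : ContDiff ℝ ∞ H) :
    ∃ H' : (Fin (m + 1) → W) → U, ContDiff ℝ ∞ H' ∧ ∀ q : ℝ → W, ContDiff ℝ ∞ q → ∀ t,
      iteratedDeriv m (fun u => H (q u)) t = H' (fun i => iteratedDeriv i q t) := by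
  induction m with
  | zero =>
    refine ⟨fun w => H (w 0), hH.comp (contDiff_apply ℝ W 0), fun q _ t => ?_⟩
    simp
  | succ m ih =>
    obtain ⟨H', hH', e⟩ := ih
    have h1 : ContDiff ℝ ∞ (fun w : Fin (m + 2) → W => fun i : Fin (m + 1) => w i.castSucc) :=
      contDiff_pi.2 fun i => contDiff_apply ℝ W _
    have h2 : ContDiff ℝ ∞ (fun w : Fin (m + 2) → W => fun i : Fin (m + 1) => w i.succ) :=
      contDiff_pi.2 fun i => contDiff_apply ℝ W _
    -- Chain rule: the tuple of derivatives of orders $0,\dots,m$ has as its derivative the same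
    -- tuple shifted by one.
    refine ⟨fun w => fderiv ℝ H' (fun i => w i.castSucc) (fun i => w i.succ),
      ((hH'.fderiv_right (m := ∞) (by simp)).comp h1).clm_apply h2, fun q hq t => ?_⟩
    rw [iteratedDeriv_succ, funext (e q hq)]
    have h3 : HasDerivAt (fun u => fun i : Fin (m + 1) => iteratedDeriv i q u)
        (fun i : Fin (m + 1) => iteratedDeriv (i + 1) q t) t := by
      refine hasDerivAt_pi.2 fun i => ?_
      rw [iteratedDeriv_succ]
      exact ((contDiff_iteratedDeriv_of_contDiff i hq).differentiable (by simp) t).hasDerivAt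
    exact ((hH'.differentiable (by simp) _).hasFDerivAt.comp_hasDerivAt t h3).deriv

/-- The mixed derivatives of `H ∘ p` of order at most `(α, β)` depend only on those of `p`. -/
theorem mixedDeriv_comp_eq {α β : ℕ} {H : W → U} (hH : ContDiff ℝ ∞ H) {p p' : ℝ × ℝ → W}
    (hp : ContDiff ℝ ∞ p) (hp' : ContDiff ℝ ∞ p')
    (h : ∀ i ≤ α, ∀ j ≤ β, mixedDeriv i j p = mixedDeriv i j p') :
    mixedDeriv α β (fun x => H (p x)) = mixedDeriv α β (fun x => H (p' x)) := by
  -- The one-variable formula is used twice: in $t$ for fixed $s$, then in $s$ for the curve formed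
  -- by the tuple of $t$-derivatives at $t=0$.
  obtain ⟨H₁, hH₁, e₁⟩ := exists_contDiff_iteratedDeriv_comp β hH
  obtain ⟨H₂, hH₂, e₂⟩ := exists_contDiff_iteratedDeriv_comp α hH₁
  have key : ∀ q : ℝ × ℝ → W, ContDiff ℝ ∞ q → mixedDeriv α β (fun x => H (q x)) =
      H₂ fun i j => mixedDeriv i j q := by
    intro q hq
    have hs : ContDiff ℝ ∞
        (fun s => fun j : Fin (β + 1) => iteratedDeriv j (fun t => q (s, t)) 0) :=
      contDiff_pi.2 fun j => (contDiff_iteratedDeriv_snd j hq).comp (contDiff_prodMk_left (0 : ℝ))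
    simp only [mixedDeriv]
    rw [funext fun s => e₁ (fun t => q (s, t)) (hq.comp (contDiff_prodMk_right s)) 0, e₂ _ hs 0]
    congr 1
    funext i j
    exact (iteratedDeriv_clm_comp i
      (ContinuousLinearMap.proj (R := ℝ) (φ := fun _ : Fin (β + 1) => W) j) hs 0).symm
  rw [key p hp, key p' hp']
  congr 1
  funext i j
  exact h i i.is_le j j.is_le

theorem mixedDeriv_prodMk_eq {α β : ℕ} {p p' : ℝ × ℝ → V} {q q' : ℝ × ℝ → W}
    (hp : ContDiff ℝ ∞ p) (hp' : ContDiff ℝ ∞ p') (hq : ContDiff ℝ ∞ q) (hq' : ContDiff ℝ ∞ q')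
    (h : mixedDeriv α β p = mixedDeriv α β p') (h' : mixedDeriv α β q = mixedDeriv α β q') :
    mixedDeriv α β (fun x => (p x, q x)) = mixedDeriv α β (fun x => (p' x, q' x)) := by
  refine Prod.ext ?_ ?_
  · have e := mixedDeriv_clm_comp α β (ContinuousLinearMap.fst ℝ V W) (hp.prodMk hq)
    have e' := mixedDeriv_clm_comp α β (ContinuousLinearMap.fst ℝ V W) (hp'.prodMk hq')
    exact e.symm.trans (h.trans e')
  · have e := mixedDeriv_clm_comp α β (ContinuousLinearMap.snd ℝ V W) (hp.prodMk hq)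
    have e' := mixedDeriv_clm_comp α β (ContinuousLinearMap.snd ℝ V W) (hp'.prodMk hq')
    exact e.symm.trans (h'.trans e')

theorem mixedDeriv_sum {ι : Type*} (s : Finset ι) (α β : ℕ) {h : ι → ℝ × ℝ → V}
    (hh : ∀ i ∈ s, ContDiff ℝ ∞ (h i)) :
    mixedDeriv α β (fun p => ∑ i ∈ s, h i p) = ∑ i ∈ s, mixedDeriv α β (h i) := by
  have h1 : (fun u => iteratedDeriv β (fun t => ∑ i ∈ s, h i (u, t)) 0) =
      fun u => ∑ i ∈ s, iteratedDeriv β (fun t => h i (u, t)) 0 := by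
    funext u
    refine iteratedDeriv_fun_sum fun i hi => ?_
    exact (((hh i hi).comp (contDiff_prodMk_right u)).of_le (by exact_mod_cast le_top)).contDiffAt
  simp only [mixedDeriv]
  rw [h1]
  refine iteratedDeriv_fun_sum fun i hi => ?_
  exact (((contDiff_iteratedDeriv_snd β (hh i hi)).comp
    (contDiff_prodMk_left (0 : ℝ))).of_le (by exact_mod_cast le_top)).contDiffAt

theorem iteratedDeriv_pow_zero (j m : ℕ) :
    iteratedDeriv m (fun t : ℝ => t ^ j) 0 = if m = j then (j.factorial : ℝ) else 0 := by
  rw [iteratedDeriv_pow]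
  split_ifs with h
  · subst h
    simp [Nat.descFactorial_self]
  · rcases lt_or_gt_of_ne h with h | h
    · simp [Nat.sub_ne_zero_of_lt h]
    · simp [Nat.descFactorial_of_lt h]

theorem mixedDeriv_monomial (i j α β : ℕ) (a : ℝ) :
    mixedDeriv α β (fun p : ℝ × ℝ => a * (p.1 ^ i * p.2 ^ j)) =
      if α = i ∧ β = j then a * (i.factorial * j.factorial) else 0 := by
  have h1 : (fun s : ℝ => iteratedDeriv β (fun t : ℝ => a * (s ^ i * t ^ j)) 0) =
      fun s : ℝ => (a * if β = j then (j.factorial : ℝ) else 0) * s ^ i := by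
    funext s
    rw [iteratedDeriv_const_mul_field, iteratedDeriv_const_mul_field, iteratedDeriv_pow_zero]
    ring
  simp only [mixedDeriv]
  rw [h1, iteratedDeriv_const_mul_field, iteratedDeriv_pow_zero]
  split_ifs <;> simp_all
  ring

theorem contDiff_monomial (i j : ℕ) (a : ℝ) :
    ContDiff ℝ ∞ (fun p : ℝ × ℝ => a * (p.1 ^ i * p.2 ^ j)) :=
  contDiff_const.mul ((contDiff_fst.pow i).mul (contDiff_snd.pow j))

/-- A map which is smooth near `x` coincides near `x` with a smooth map. -/
theorem exists_contDiff_eventuallyEq [FiniteDimensional ℝ W] {H : W → U} {x : W} {O : Set W}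
    (hO : IsOpen O) (hx : x ∈ O) (hH : ContDiffOn ℝ ∞ H O) :
    ∃ H' : W → U, ContDiff ℝ ∞ H' ∧ H' =ᶠ[𝓝 x] H := by
  obtain ⟨ε, hε, hb⟩ := Metric.isOpen_iff.1 hO x hx
  let χ : ContDiffBump x := ⟨ε / 4, ε / 2, by positivity, by linarith⟩
  refine ⟨fun y => χ y • H y, ?_, ?_⟩
  · refine contDiff_iff_contDiffAt.2 fun y => ?_
    by_cases hy : y ∈ O
    · exact χ.contDiff.contDiffAt.smul (hH.contDiffAt (hO.mem_nhds hy))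
    · have hs : y ∉ tsupport χ := fun h => hy <| hb <| by
        rw [χ.tsupport_eq] at h
        exact Metric.closedBall_subset_ball (by change ε / 2 < ε; linarith) h
      have h0 : (fun z => χ z • H z) =ᶠ[𝓝 y] fun _ => 0 := by
        filter_upwards [(isClosed_tsupport χ).isOpen_compl.mem_nhds hs] with z hz
        rw [image_eq_zero_of_notMem_tsupport hz, zero_smul]
      exact contDiffAt_const.congr_of_eventuallyEq h0
  · filter_upwards [χ.eventuallyEq_one] with y hy
    rw [hy]
    exact one_smul ℝ _

end MixedDeriv

/-! ### Velocities in charts and germs of curves -/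

section Jets

variable {EN HN : Type*} [NormedAddCommGroup EN] [NormedSpace ℝ EN] [TopologicalSpace HN]
  {I : ModelWithCorners ℝ EN HN} {N : Type*} [TopologicalSpace N] [ChartedSpace HN N]

theorem curveSetoid_of_eventuallyEq (m : ℕ) {c c' : Curve I N} (h : c =ᶠ[𝓝 0] c') :
    curveSetoid I N m c c' :=
  ⟨h.eq_of_nhds, fun f r _ => Filter.EventuallyEq.iteratedDeriv_eq r (h.fun_comp f)⟩

/-- Two surfaces which near `0` are images under one smooth map `Ψ` of maps with the same mixed
derivatives have the same velocity. -/
theorem surfaceSetoid_of_eventuallyEq_comp {W : Type*} [NormedAddCommGroup W] [NormedSpace ℝ W]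
    [FiniteDimensional ℝ W] {k l : ℕ} {γ γ' : Surface I N} {Ψ : W → N} {O : Set W}
    (hO : IsOpen O) (hΨ : ContMDiffOn 𝓘(ℝ, W) I ∞ Ψ O) {p p' : ℝ × ℝ → W}
    (hp : ContDiff ℝ ∞ p) (hp' : ContDiff ℝ ∞ p') (hmem : p 0 ∈ O)
    (hγ : γ =ᶠ[𝓝 0] fun x => Ψ (p x)) (hγ' : γ' =ᶠ[𝓝 0] fun x => Ψ (p' x))
    (h : ∀ α ≤ k, ∀ β ≤ l, mixedDeriv α β p = mixedDeriv α β p') :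
    surfaceSetoid I N k l γ γ' := by
  have h0 : p 0 = p' 0 := by
    have h1 := h 0 (Nat.zero_le k) 0 (Nat.zero_le l)
    simp only [mixedDeriv, iteratedDeriv_zero] at h1
    exact h1
  refine ⟨by rw [hγ.eq_of_nhds, hγ'.eq_of_nhds, h0], fun f α hα β hβ => ?_⟩
  obtain ⟨H, hH, eH⟩ := exists_contDiff_eventuallyEq (H := fun w => f (Ψ w)) hO hmem
    (contMDiffOn_iff_contDiffOn.1 (f.contMDiff.comp_contMDiffOn hΨ))
  have e : (fun x => f (γ x)) =ᶠ[𝓝 0] fun x => H (p x) := by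
    filter_upwards [hγ, hp.continuous.continuousAt.eventually eH] with x h1 h2
    rw [h1, h2]
  have e' : (fun x => f (γ' x)) =ᶠ[𝓝 0] fun x => H (p' x) := by
    rw [h0] at eH
    filter_upwards [hγ', hp'.continuous.continuousAt.eventually eH] with x h1 h2
    rw [h1, h2]
  rw [mixedDeriv_congr α β e, mixedDeriv_congr α β e']
  exact mixedDeriv_comp_eq hH hp hp' fun i hi j hj => h i (hi.trans hα) j (hj.trans hβ)

/-- The chart at `x` extends, from a neighbourhood of `x`, to a smooth map on the manifold. -/
theorem exists_extChartAt_extension [FiniteDimensional ℝ EN] [T2Space N] [I.Boundaryless]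
    [IsManifold I ∞ N] (x : N) :
    ∃ y : C^∞⟮I, N; 𝓘(ℝ, EN), EN⟯, y =ᶠ[𝓝 x] extChartAt I x := by
  obtain ⟨χ⟩ : Nonempty (SmoothBumpFunction I x) := inferInstance
  refine ⟨⟨fun z => χ z • extChartAt I x z, χ.contMDiff_smul contMDiffOn_extChartAt⟩, ?_⟩
  filter_upwards [χ.eventuallyEq_one] with z hz
  change χ z • extChartAt I x z = _
  rw [hz]
  exact one_smul ℝ _

/-- Velocities are defined by testing against real functions; continuous linear functionals separate
points, so vector-valued functions may serve as tests too. -/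
theorem mixedDeriv_comp_eq_of_surfaceSetoid {W : Type*} [NormedAddCommGroup W] [NormedSpace ℝ W]
    {k l : ℕ} {γ γ' : Surface I N} (h : surfaceSetoid I N k l γ γ')
    (y : C^∞⟮I, N; 𝓘(ℝ, W), W⟯) {α β : ℕ} (hα : α ≤ k) (hβ : β ≤ l) :
    mixedDeriv α β (fun p => y (γ p)) = mixedDeriv α β (fun p => y (γ' p)) := by
  have smooth : ∀ δ : Surface I N, ContDiff ℝ ∞ (fun p => y (δ p)) := fun δ =>
    contMDiff_iff_contDiff.1 (y.contMDiff.comp δ.contMDiff)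
  rw [SeparatingDual.eq_iff_forall_dual_eq (R := ℝ)]
  intro φ
  rw [← mixedDeriv_clm_comp α β φ (smooth γ), ← mixedDeriv_clm_comp α β φ (smooth γ')]
  exact h.2 ⟨fun e => φ (y e), φ.contMDiff.comp y.contMDiff⟩ α hα β hβ

/-- Every curve coincides near `0` with a curve which stays in a given neighbourhood of its
initial point. -/
theorem Curve.exists_eventuallyEq_mem (c : Curve I N) {O : Set N} (hO : O ∈ 𝓝 (c 0)) :
    ∃ c' : Curve I N, c' =ᶠ[𝓝 0] c ∧ ∀ t, c' t ∈ O := by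
  obtain ⟨ε, hε, hb⟩ := Metric.mem_nhds_iff.1 (c.contMDiff.continuous.continuousAt hO)
  let χ : ContDiffBump (0 : ℝ) := ⟨ε / 4, ε / 2, by positivity, by linarith⟩
  -- The reparametrization $t\mapsto\chi(t)t$ is the identity near $0$ and has all its values in the
  -- ball of radius $\varepsilon$.
  let ρ : Curve 𝓘(ℝ, ℝ) ℝ := ⟨fun t => χ t * t, (χ.contDiff.mul contDiff_id).contMDiff⟩
  refine ⟨c.comp ρ, ?_, fun t => hb ?_⟩
  · filter_upwards [χ.eventuallyEq_one] with t ht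
    change c (χ t * t) = c t
    rw [ht]
    simp
  · change χ t * t ∈ Metric.ball 0 ε
    rw [mem_ball_zero_iff, norm_mul]
    by_cases ht : ‖t‖ < ε / 2
    · rw [Real.norm_of_nonneg χ.nonneg]
      have := mul_le_mul_of_nonneg_right (χ.le_one (x := t)) (norm_nonneg t)
      linarith
    · rw [χ.zero_of_le_dist (by rw [dist_zero_right]; exact not_lt.1 ht)]
      simpa using hε

end Jets


/-! ### Trivial bundles over the line and their morphisms -/

/-- The real line, as a one-dimensional manifold. -/
abbrev Line := EuclideanSpace ℝ (Fin 1)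

/-- The identification of `ℝ` with `Line`. -/
def toLine : ℝ →L[ℝ] Line :=
  (ContinuousLinearMap.id ℝ ℝ).smulRight (EuclideanSpace.single (0 : Fin 1) (1 : ℝ))

/-- The coordinate of `Line`. -/
def ofLine : Line →L[ℝ] ℝ := EuclideanSpace.proj (0 : Fin 1)

@[simp] theorem ofLine_toLine (t : ℝ) : ofLine (toLine t) = t := by
  simp [ofLine, toLine]

/-- The standard parametrization of `Line`. -/
def lineCurve : Curve (𝓡 1) Line := ⟨toLine, toLine.contDiff.contMDiff⟩

/-- The map from `Line` to a manifold which corresponds to a curve. -/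
def curveMap {n : ℕ} {M : Type*} [TopologicalSpace M] [ChartedSpace (EuclideanSpace ℝ (Fin n)) M]
    (c : Curve (𝓡 n) M) : C^∞⟮𝓡 1, Line; 𝓡 n, M⟯ :=
  ⟨fun x => c (ofLine x), c.contMDiff.comp ofLine.contDiff.contMDiff⟩

theorem curveMap_comp_lineCurve {n : ℕ} {M : Type*} [TopologicalSpace M]
    [ChartedSpace (EuclideanSpace ℝ (Fin n)) M] (c : Curve (𝓡 n) M) :
    (curveMap c).comp lineCurve = c := by
  ext t
  change c (ofLine (toLine t)) = c t
  rw [ofLine_toLine]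

section LineBundle

variable (V : Type) [NormedAddCommGroup V] [NormedSpace ℝ V] [FiniteDimensional ℝ V]

/-- The trivial bundle over the line with fibre `V`. -/
def lineBundle : VB where
  n := 1
  M := Line
  F := V
  fiber := Bundle.Trivial Line V

variable {V}

/-- A point of the total space of a trivial bundle over the line. -/
def linePoint (x : Line) (v : V) : (lineBundle V).Total := ⟨x, v⟩

/-- The fibre component of a point of a trivial bundle over the line. -/
def lineSnd (e : (lineBundle V).Total) : V := e.2

theorem contMDiff_lineBundle_iff {EP HP P : Type*} [NormedAddCommGroup EP] [NormedSpace ℝ EP]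
    [TopologicalSpace HP] {J : ModelWithCorners ℝ EP HP} [TopologicalSpace P] [ChartedSpace HP P]
    {f : P → (lineBundle V).Total} :
    ContMDiff J (lineBundle V).model ∞ f ↔
      ContMDiff J (𝓡 (lineBundle V).n) ∞ (fun x => (f x).proj) ∧
        ContMDiff J 𝓘(ℝ, V) ∞ (fun x => lineSnd (f x)) := by
  constructor
  · intro h
    exact ⟨fun x => (contMDiffAt_totalSpace.1 (h x)).1, fun x => (contMDiffAt_totalSpace.1 (h x)).2⟩
  · intro h x
    exact contMDiffAt_totalSpace.2 ⟨h.1 x, h.2 x⟩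

theorem contMDiff_lineSnd : ContMDiff (lineBundle V).model 𝓘(ℝ, V) ∞ (lineSnd (V := V)) :=
  (contMDiff_lineBundle_iff.1 contMDiff_id).2

/-- The surface `(s, t) ↦ (s + t, g (s, t))` in a trivial bundle over the line. -/
def lineSurface (g : ℝ × ℝ → V) (hg : ContDiff ℝ ∞ g) :
    Surface (lineBundle V).model (lineBundle V).Total :=
  ⟨fun p => linePoint (toLine (p.1 + p.2)) (g p), contMDiff_lineBundle_iff.2
    ⟨(toLine.contDiff.comp (contDiff_fst.add contDiff_snd)).contMDiff, hg.contMDiff⟩⟩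

/-- The semi-holonomic vector of `(s, t) ↦ (s + t, g (s, t))`. -/
def lineVector (k : ℕ) (g : ℝ × ℝ → V) (hg : ContDiff ℝ ∞ g) : SemiHol k (lineBundle V) :=
  ⟨(TT.mk (k + k) lineCurve, TT2.mk k k (lineSurface g hg)), rfl⟩

/-- The zero morphism over a curve. -/
def zeroHom (V : Type) [NormedAddCommGroup V] [NormedSpace ℝ V] [FiniteDimensional ℝ V] {E : VB}
    (c : Curve (𝓡 E.n) E.M) : VBHom (lineBundle V) E where
  base := curveMap c
  onFiber _ := 0
  smooth := (contMDiff_zeroSection ℝ E.fiber).comp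
    ((curveMap c).contMDiff.comp (lineBundle V).sigma.contMDiff)

theorem trivializationAt_mk_symmₗ {E : VB} {x₀ x : E.M}
    (hx : x ∈ (trivializationAt E.F E.fiber x₀).baseSet) (v : E.F) :
    trivializationAt E.F E.fiber x₀ ⟨x, (trivializationAt E.F E.fiber x₀).symmₗ ℝ x v⟩ =
      (x, v) := by
  rw [Trivialization.symmₗ_apply _ hx, Trivialization.apply_mk_symm _ hx]

/-- The morphism from a trivial bundle to `E` over a curve in the domain of a trivialization. -/
def trivHom {E : VB} (x₀ : E.M) (c : Curve (𝓡 E.n) E.M)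
    (hc : ∀ t, c t ∈ (trivializationAt E.F E.fiber x₀).baseSet) : VBHom (lineBundle E.F) E where
  base := curveMap c
  onFiber x := (trivializationAt E.F E.fiber x₀).symmₗ ℝ (curveMap c x)
  smooth := by
    have h1 := (curveMap c).contMDiff.comp (lineBundle E.F).sigma.contMDiff
    intro e
    refine ((trivializationAt E.F E.fiber x₀).contMDiffAt_iff ?_).2 ⟨h1 e, ?_⟩
    · exact (trivializationAt E.F E.fiber x₀).mem_source.2 (hc _)
    · refine (contMDiff_lineSnd e).congr_of_eventuallyEq (Eventually.of_forall fun e' => ?_)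
      exact congrArg Prod.snd (trivializationAt_mk_symmₗ (x := curveMap c e'.proj) (hc _) e'.2)

theorem trivHom_total {E : VB} (x₀ : E.M) (c : Curve (𝓡 E.n) E.M)
    (hc : ∀ t, c t ∈ (trivializationAt E.F E.fiber x₀).baseSet) (x : Line) (v : E.F) :
    trivializationAt E.F E.fiber x₀ ((trivHom x₀ c hc).total (linePoint x v)) =
      (c (ofLine x), v) :=
  trivializationAt_mk_symmₗ (x := curveMap c x) (hc _) v

/-- The morphism of trivial bundles over the line which multiplies by a linear map. -/
def linearHom {V W : Type} [NormedAddCommGroup V] [NormedSpace ℝ V] [FiniteDimensional ℝ V]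
    [NormedAddCommGroup W] [NormedSpace ℝ W] [FiniteDimensional ℝ W] (φ : V →L[ℝ] W) :
    VBHom (lineBundle V) (lineBundle W) where
  base := ContMDiffMap.id
  onFiber _ := φ.toLinearMap
  smooth := contMDiff_lineBundle_iff.2
    ⟨(lineBundle V).sigma.contMDiff, φ.contMDiff.comp contMDiff_lineSnd⟩

/-- The endomorphism of the trivial line bundle which multiplies by the coordinate of the base. -/
def coordHom : VBHom (lineBundle ℝ) (lineBundle ℝ) where
  base := ContMDiffMap.id
  onFiber x := ofLine x • LinearMap.id
  smooth := contMDiff_lineBundle_iff.2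
    ⟨(lineBundle ℝ).sigma.contMDiff,
      ((ofLine.contMDiff.comp (lineBundle ℝ).sigma.contMDiff).smul contMDiff_lineSnd).congr
        fun _ => rfl⟩

/-- The base component is $s+t$ on both sides, so only the derivatives of the fibre component can
distinguish the two velocities. -/
theorem lineVector_congr {k : ℕ} {g g' : ℝ × ℝ → V} (hg : ContDiff ℝ ∞ g) (hg' : ContDiff ℝ ∞ g')
    (h : ∀ α ≤ k, ∀ β ≤ k, mixedDeriv α β g = mixedDeriv α β g') :
    lineVector k g hg = lineVector k g' hg' := by
  refine Subtype.ext (Prod.ext rfl (Quotient.sound ?_))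
  have hs : ContDiff ℝ ∞ (fun p : ℝ × ℝ => toLine (p.1 + p.2)) :=
    toLine.contDiff.comp (contDiff_fst.add contDiff_snd)
  refine surfaceSetoid_of_eventuallyEq_comp (N := (lineBundle V).Total) (W := Line × V) (O := univ)
    (Ψ := fun w => linePoint w.1 w.2) (p := fun p => (toLine (p.1 + p.2), g p))
    (p' := fun p => (toLine (p.1 + p.2), g' p)) isOpen_univ ?_ (hs.prodMk hg) (hs.prodMk hg')
    (mem_univ _) EventuallyEq.rfl EventuallyEq.rfl fun α hα β hβ =>
      mixedDeriv_prodMk_eq hs hs hg hg' rfl (h α hα β hβ)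
  exact (contMDiff_lineBundle_iff.2
    ⟨contDiff_fst.contMDiff, contDiff_snd.contMDiff⟩).contMDiffOn

theorem contDiff_add_mul {g : ℝ × ℝ → ℝ} (hg : ContDiff ℝ ∞ g) :
    ContDiff ℝ ∞ (fun p : ℝ × ℝ => (p.1 + p.2) * g p) :=
  (contDiff_fst.add contDiff_snd).mul hg

/-- On the representing surface the base coordinate is $s+t$, so multiplication by it acts on $g$ as
multiplication by $s+t$. -/
theorem lineVector_map_coordHom {k : ℕ} (g : ℝ × ℝ → ℝ) (hg : ContDiff ℝ ∞ g) :
    (lineVector k g hg).map coordHom =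
      lineVector k (fun p => (p.1 + p.2) * g p) (contDiff_add_mul hg) := by
  refine Subtype.ext (Prod.ext rfl (Quotient.sound ?_))
  have e : coordHom.total.comp (lineSurface g hg) =
      lineSurface (fun p => (p.1 + p.2) * g p) (contDiff_add_mul hg) := by
    refine ContMDiffMap.ext fun p => ?_
    change linePoint (toLine (p.1 + p.2)) (ofLine (toLine (p.1 + p.2)) * g p) =
      linePoint (toLine (p.1 + p.2)) ((p.1 + p.2) * g p)
    rw [ofLine_toLine]
  exact e ▸ (surfaceSetoid _ _ k k).refl _

theorem lineVector_isSum {k : ℕ} {g g' : ℝ × ℝ → V} (hg : ContDiff ℝ ∞ g)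
    (hg' : ContDiff ℝ ∞ g') :
    SemiHol.IsSum (lineVector k g hg) (lineVector k g' hg')
      (lineVector k (fun p => g p + g' p) (hg.add hg')) :=
  ⟨rfl, rfl, lineSurface g hg, lineSurface g' hg', lineSurface _ (hg.add hg'),
    fun _ => ⟨_, _, _, rfl, rfl, rfl⟩, rfl, rfl, rfl⟩

theorem lineVector_isSMul {k : ℕ} (r : ℝ) {g : ℝ × ℝ → V} (hg : ContDiff ℝ ∞ g) :
    SemiHol.IsSMul r (lineVector k g hg) (lineVector k (fun p => r • g p) (contDiff_const.smul hg)) :=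
  ⟨rfl, lineSurface g hg, lineSurface _ (contDiff_const.smul hg),
    fun _ => ⟨_, _, rfl, rfl⟩, rfl, rfl⟩

theorem lineSnd_isSum {a b c : (lineBundle V).Total} (h : VB.IsSum a b c) :
    lineSnd c = lineSnd a + lineSnd b := by
  obtain ⟨x, u, v, rfl, rfl, rfl⟩ := h
  rfl

theorem lineSnd_isSMul {r : ℝ} {a b : (lineBundle V).Total} (h : VB.IsSMul r a b) :
    lineSnd b = r • lineSnd a := by
  obtain ⟨x, u, rfl, rfl⟩ := h
  rfl

end LineBundle

/-! ### Reduction to the line -/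

/-- Every semi-holonomic vector of `E` is the image of a semi-holonomic vector of a trivial bundle
over the line, under a morphism given by a trivialization. -/
theorem SemiHol.exists_eq_map_lineVector {k : ℕ} {E : VB} (Φ : SemiHol k E) :
    ∃ (c : Curve (𝓡 E.n) E.M)
      (hc : ∀ t, c t ∈ (trivializationAt E.F E.fiber (c 0)).baseSet)
      (g : ℝ × ℝ → E.F) (hg : ContDiff ℝ ∞ g),
      Φ = (lineVector k g hg).map (trivHom (c 0) c hc) := by
  obtain ⟨⟨v, X⟩, hΦ⟩ := Φ
  induction v using Quotient.inductionOn with | h c₀ => ?_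
  induction X using Quotient.inductionOn with | h γ => ?_
  -- The points `c₀ 0`, `c 0` and `(γ 0).proj` are only propositionally equal; a separate name lets
  -- each be rewritten to it inside the dependent trivialization.
  obtain ⟨x₀, hx₀⟩ : ∃ x₀, x₀ = c₀ 0 := ⟨_, rfl⟩
  set T := trivializationAt E.F E.fiber x₀ with hT
  have hU : T.baseSet ∩ (extChartAt (𝓡 E.n) x₀).source ∈ 𝓝 (c₀ 0) := by
    rw [← hx₀]
    exact inter_mem (T.open_baseSet.mem_nhds (FiberBundle.mem_baseSet_trivializationAt' x₀))
      (extChartAt_source_mem_nhds x₀)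
  -- A morphism from a bundle over the whole line needs the trivialization at every $c(t)$, not only
  -- near $t=0$.
  obtain ⟨c, hcc, hcU⟩ := c₀.exists_eventuallyEq_mem hU
  have hc0 : c 0 = x₀ := hcc.eq_of_nhds.trans hx₀.symm
  -- The semi-holonomic condition, transferred to the shrunk curve: $\sigma\circ\gamma$ and $c(s+t)$
  -- have the same velocity.
  have hjet : surfaceSetoid (𝓡 E.n) E.M k k (E.sigma.comp γ) (c.comp addMap) := by
    have h1 : surfaceSetoid (𝓡 E.n) E.M k k (E.sigma.comp γ) (c₀.comp addMap) := Quotient.exact hΦ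
    refine (surfaceSetoid (𝓡 E.n) E.M k k).trans h1 (Quotient.exact
      (congrArg (TT.iota k k) (Quotient.sound (s := curveSetoid (𝓡 E.n) E.M (k + k))
        (curveSetoid_of_eventuallyEq (k + k) hcc.symm))))
  have hγ0 : (γ 0).proj = x₀ := by
    have h1 : (γ 0).proj = c (0 + 0) := hjet.1
    rw [h1, add_zero, hc0]
  obtain ⟨y, hy⟩ := exists_fiberCoord_extension E x₀
  obtain ⟨z, hz⟩ := exists_extChartAt_extension (I := 𝓡 E.n) x₀
  have hg : ContDiff ℝ ∞ (fun p => y (γ p)) :=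
    contMDiff_iff_contDiff.1 (y.contMDiff.comp γ.contMDiff)
  have hz1 : ContDiff ℝ ∞ (fun p => z (γ p).proj) :=
    contMDiff_iff_contDiff.1 (z.contMDiff.comp (E.sigma.comp γ).contMDiff)
  have hz2 : ContDiff ℝ ∞ (fun p => z ((c.comp addMap) p)) :=
    contMDiff_iff_contDiff.1 (z.contMDiff.comp (c.comp addMap).contMDiff)
  have hcT : ∀ t, c t ∈ (trivializationAt E.F E.fiber (c 0)).baseSet := by
    rw [hc0]
    exact fun t => (hcU t).1
  -- The fibre coordinate of $\gamma$ makes sense only near $0$; its global smooth extension `y`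
  -- makes $g$ smooth on the whole plane without changing its germ.
  refine ⟨c, hcT, fun p => y (γ p), hg, Subtype.ext (Prod.ext ?_ (Quotient.sound ?_))⟩
  · change TT.mk (k + k) c₀ = TT.mk (k + k) ((curveMap c).comp lineCurve)
    rw [curveMap_comp_lineCurve]
    exact Quotient.sound (curveSetoid_of_eventuallyEq _ hcc.symm)
  have hext : ∀ e : E.Total, extChartAt E.model (γ 0) e =
      (extChartAt (𝓡 E.n) x₀ (T e).1, (T e).2) := by
    intro e
    rw [FiberBundle.extChartAt, hγ0]
    rfl
  have hsrc : ∀ e : E.Total, e ∈ (extChartAt E.model (γ 0)).source ↔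
      e.proj ∈ T.baseSet ∧ e.proj ∈ (extChartAt (𝓡 E.n) x₀).source := by
    intro e
    rw [FiberBundle.extChartAt, hγ0]
    simp only [PartialEquiv.trans_source, OpenPartialHomeomorph.toFun_eq_coe,
      PartialEquiv.prod_source, PartialEquiv.refl_source, mem_inter_iff, mem_preimage, mem_prod,
      mem_univ, and_true]
    refine (and_congr_left' T.mem_source).trans (and_congr_right fun h => ?_)
    exact iff_of_eq (congrArg (· ∈ (extChartAt (𝓡 E.n) x₀).source) (T.coe_fst' h))
  have hγc : ∀ᶠ p in 𝓝 0, γ p ∈ (extChartAt E.model (γ 0)).source :=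
    γ.contMDiff.continuous.continuousAt.eventually (extChartAt_source_mem_nhds (γ 0))
  have hpc : Tendsto (fun p => (γ p).proj) (𝓝 0) (𝓝 x₀) := by
    have h1 := (E.sigma.comp γ).contMDiff.continuous.continuousAt (x := 0)
    rw [← hγ0]
    exact h1
  have hcc' : Tendsto (fun p => (c.comp addMap) p) (𝓝 0) (𝓝 x₀) := by
    have h1 := (c.comp addMap).contMDiff.continuous.continuousAt (x := 0)
    rwa [ContinuousAt, ← hjet.1, show (E.sigma.comp γ) 0 = x₀ from hγ0] at h1
  have hleft : γ =ᶠ[𝓝 0]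
      fun p => (extChartAt E.model (γ 0)).symm (z (γ p).proj, y (γ p)) := by
    filter_upwards [hγc, hpc.eventually hz, hpc.eventually hy] with p h1 h2 h3
    rw [h2, h3 _ rfl, ← (hsrc _ |>.1 h1).1 |> T.coe_fst', ← hext, PartialEquiv.left_inv _ h1]
  have htot : ∀ x v, T ((trivHom (c 0) c hcT).total (linePoint x v)) = (c (ofLine x), v) := by
    intro x v
    have h1 := trivHom_total (c 0) c hcT x v
    simp only [hc0] at h1 ⊢
    exact h1
  have hright : (trivHom (c 0) c hcT).total.comp (lineSurface (fun p => y (γ p)) hg) =ᶠ[𝓝 0]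
      fun p => (extChartAt E.model (γ 0)).symm (z ((c.comp addMap) p), y (γ p)) := by
    filter_upwards [hcc'.eventually hz] with p h2
    have h4 := htot (toLine (p.1 + p.2)) (y (γ p))
    rw [ofLine_toLine] at h4
    have h5 : (trivHom (c 0) c hcT).total (linePoint (toLine (p.1 + p.2)) (y (γ p))) ∈
        (extChartAt E.model (γ 0)).source := (hsrc _).2 (hcU _)
    have h6 := hext ((trivHom (c 0) c hcT).total (linePoint (toLine (p.1 + p.2)) (y (γ p))))
    rw [h4] at h6
    rw [h2]
    exact (PartialEquiv.left_inv _ h5).symm.trans (congrArg _ h6)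
  -- Through the inverse chart of $E$, both surfaces have the same fibre coordinate, and their base
  -- coordinates have equal mixed derivatives by `hjet`.
  refine surfaceSetoid_of_eventuallyEq_comp (isOpen_extChartAt_target (I := E.model) (γ 0))
    (contMDiffOn_extChartAt_symm (n := ∞) (γ 0)) (hz1.prodMk hg) (hz2.prodMk hg) ?_
    hleft hright fun α hα β hβ => mixedDeriv_prodMk_eq hz1 hz2 hg hg
      (mixedDeriv_comp_eq_of_surfaceSetoid hjet z hα hβ) rfl
  have h1 : (extChartAt E.model (γ 0)) (γ 0) ∈ (extChartAt E.model (γ 0)).target :=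
    mem_extChartAt_target (γ 0)
  have h2 : (T (γ 0)).1 = (γ 0).proj :=
    T.coe_fst' ((hsrc _).1 (mem_extChartAt_source (γ 0))).1
  rw [hext, h2, ← hy.self_of_nhds _ hγ0, hγ0, ← hz.self_of_nhds, ← hγ0] at h1
  exact h1


/-! ### The base map and the values on the line -/

section Functorial

variable {k : ℕ}

/-- A family of maps from semi-holonomic vectors to vector bundles commutes with the maps induced
by morphisms of vector bundles. -/
def IsFunctorial (F : ∀ E : VB, SemiHol k E → E.Total) : Prop :=
  ∀ (E₁ E₂ : VB) (f : VBHom E₁ E₂) (Φ : SemiHol k E₁), F E₂ (Φ.map f) = f.total (F E₁ Φ)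

variable {F : ∀ E : VB, SemiHol k E → E.Total}
  {b : ∀ E : VB, TT (𝓡 E.n) E.M (k + k) → E.M}

/-- A zero morphism exists over every curve and carries the jet of the standard parametrization of
the line to the jet of that curve, so naturality reduces the base map to one point of the line. -/
theorem IsFunctorial.base_mk (hnat : IsFunctorial F)
    (hF : ∀ E, SemiHol.IsMorphism (F E) (b E)) (E : VB) (c : Curve (𝓡 E.n) E.M) :
    b E (TT.mk (k + k) c) = c (ofLine (b (lineBundle ℝ) (TT.mk (k + k) lineCurve))) := by
  set Φ : SemiHol k (lineBundle ℝ) := lineVector k (fun _ => (0 : ℝ)) contDiff_const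
  have h1 := (hF E).covers (Φ.map (zeroHom ℝ c))
  rw [hnat] at h1
  have h2 := (hF (lineBundle ℝ)).covers Φ
  have h3 : curveMap c (F (lineBundle ℝ) Φ).proj = b E (TT.mk (k + k) c) := by
    refine h1.trans (congrArg (b E) ?_)
    change TT.mk (k + k) ((curveMap c).comp lineCurve) = _
    rw [curveMap_comp_lineCurve]
  exact h3.symm.trans (congrArg (curveMap c) h2)

/-- A functorial morphism from semi-holonomic vectors covers the projection of `T^{2k} M`. -/
theorem IsFunctorial.base_eq_proj (hnat : IsFunctorial F)
    (hF : ∀ E, SemiHol.IsMorphism (F E) (b E)) (E : VB) (v : TT (𝓡 E.n) E.M (k + k)) :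
    b E v = v.proj := by
  induction v using Quotient.inductionOn with | h c => ?_
  refine (hnat.base_mk hF E c).trans ?_
  change _ = c 0
  congr 1
  set r : ℝ := ofLine (b (lineBundle ℝ) (TT.mk (k + k) lineCurve)) with hr
  by_contra hr0
  have hpos : 0 < |r| := abs_pos.2 hr0
  -- If $r\neq0$, the curve $1-\chi$ is constantly $0$ near $0$ but equals $1$ at $r$: it shares its
  -- jet with the zero curve, yet differs from it at $r$.
  let χ : ContDiffBump (0 : ℝ) := ⟨|r| / 2, |r|, by positivity, by linarith⟩
  let d : Curve (𝓡 1) Line := ⟨fun t => toLine (1 - χ t),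
    (toLine.contDiff.comp (contDiff_const.sub χ.contDiff)).contMDiff⟩
  let d₀ : Curve (𝓡 1) Line := ⟨fun _ => toLine 0, contMDiff_const⟩
  have hd : TT.mk (k + k) d = TT.mk (k + k) d₀ := by
    refine Quotient.sound (curveSetoid_of_eventuallyEq _ ?_)
    filter_upwards [χ.eventuallyEq_one] with t ht
    change toLine (1 - χ t) = toLine 0
    rw [ht]
    simp
  have h1 : toLine (1 - χ r) = toLine 0 :=
    (hnat.base_mk hF (lineBundle ℝ) d).symm.trans
      ((congrArg (b (lineBundle ℝ)) hd).trans (hnat.base_mk hF (lineBundle ℝ) d₀))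
  have h2 : χ r = 0 := χ.zero_of_le_dist (by simp [χ])
  have h3 := congrArg ofLine h1
  rw [h2] at h3
  simp at h3

variable {V : Type} [NormedAddCommGroup V] [NormedSpace ℝ V] [FiniteDimensional ℝ V]

/-- The fibre component of the value at `(s, t) ↦ (s + t, g (s, t))`. -/
def lineValue (F : ∀ E : VB, SemiHol k E → E.Total) (g : ℝ × ℝ → V) (hg : ContDiff ℝ ∞ g) : V :=
  lineSnd (F (lineBundle V) (lineVector k g hg))

theorem lineValue_congr {g g' : ℝ × ℝ → V} (hg : ContDiff ℝ ∞ g) (hg' : ContDiff ℝ ∞ g')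
    (h : ∀ α ≤ k, ∀ β ≤ k, mixedDeriv α β g = mixedDeriv α β g') :
    lineValue F g hg = lineValue F g' hg' := by
  rw [lineValue, lineVector_congr hg hg' h, lineValue]

theorem lineValue_add (hF : ∀ E, SemiHol.IsMorphism (F E) (b E)) {g g' : ℝ × ℝ → V}
    (hg : ContDiff ℝ ∞ g) (hg' : ContDiff ℝ ∞ g') :
    lineValue F (fun p => g p + g' p) (hg.add hg') = lineValue F g hg + lineValue F g' hg' :=
  lineSnd_isSum ((hF _).add _ _ _ (lineVector_isSum hg hg'))

theorem lineValue_smul (hF : ∀ E, SemiHol.IsMorphism (F E) (b E)) (r : ℝ) {g : ℝ × ℝ → V}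
    (hg : ContDiff ℝ ∞ g) :
    lineValue F (fun p => r • g p) (contDiff_const.smul hg) = r • lineValue F g hg :=
  lineSnd_isSMul ((hF _).smul _ _ _ (lineVector_isSMul r hg))

theorem lineValue_zero (hF : ∀ E, SemiHol.IsMorphism (F E) (b E)) :
    lineValue F (fun _ => (0 : V)) contDiff_const = 0 := by
  have h := lineValue_add (V := V) hF (g := fun _ => 0) (g' := fun _ => 0)
    contDiff_const contDiff_const
  simp only [add_zero] at h
  exact left_eq_add.1 h

theorem lineValue_sum (hF : ∀ E, SemiHol.IsMorphism (F E) (b E)) {ι : Type*} (s : Finset ι)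
    {g : ι → ℝ × ℝ → V} (hg : ∀ i, ContDiff ℝ ∞ (g i)) :
    lineValue F (fun p => ∑ i ∈ s, g i p) (ContDiff.sum fun i _ => hg i) =
      ∑ i ∈ s, lineValue F (g i) (hg i) := by
  classical
  induction s using Finset.induction_on with
  | empty => simpa using lineValue_zero hF
  | insert i s hi ih =>
    simp only [Finset.sum_insert hi]
    rw [← ih]
    exact lineValue_add hF (hg i) _

/-- Naturality under the constant morphism $\varphi$; this reduces vector-valued $g$ to real-valued
$g$. -/
theorem lineValue_linear (hnat : IsFunctorial F) (φ : V →L[ℝ] ℝ) {g : ℝ × ℝ → V}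
    (hg : ContDiff ℝ ∞ g) :
    lineValue F (fun p => φ (g p)) (φ.contDiff.comp hg) = φ (lineValue F g hg) :=
  congrArg lineSnd (hnat _ _ (linearHom φ) (lineVector k g hg))

theorem IsFunctorial.apply_lineVector (hnat : IsFunctorial F)
    (hF : ∀ E, SemiHol.IsMorphism (F E) (b E)) {g : ℝ × ℝ → V} (hg : ContDiff ℝ ∞ g) :
    F (lineBundle V) (lineVector k g hg) = linePoint (lineCurve 0) (lineValue F g hg) := by
  have h := (hF (lineBundle V)).covers (lineVector k g hg)
  rw [hnat.base_eq_proj hF] at h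
  have h' : (F (lineBundle V) (lineVector k g hg)).proj = lineCurve 0 := h
  rw [← h']
  rfl

/-- Naturality under multiplication by the base coordinate, which is zero on the fibre over $0$ that
contains the value of $F$. -/
theorem lineValue_add_mul (hnat : IsFunctorial F) (hF : ∀ E, SemiHol.IsMorphism (F E) (b E))
    {g : ℝ × ℝ → ℝ} (hg : ContDiff ℝ ∞ g) :
    lineValue F (fun p : ℝ × ℝ => (p.1 + p.2) * g p) (contDiff_add_mul hg) = 0 := by
  have h := hnat _ _ coordHom (lineVector k g hg)
  rw [lineVector_map_coordHom, hnat.apply_lineVector hF hg] at h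
  refine (congrArg lineSnd h).trans ?_
  change ofLine (toLine 0) * lineValue F g hg = 0
  rw [ofLine_toLine, zero_mul]

/-! ### Monomials and the universal constants -/

/-- The value at the monomial `s ^ i * t ^ j`. -/
def monomialValue (F : ∀ E : VB, SemiHol k E → E.Total) (i j : ℕ) : ℝ :=
  lineValue F _ (contDiff_monomial i j 1)

/-- The sum of the two monomials is $(s+t)s^it^j$, which $F$ kills. -/
theorem monomialValue_succ (hnat : IsFunctorial F) (hF : ∀ E, SemiHol.IsMorphism (F E) (b E))
    (i j : ℕ) : monomialValue F (i + 1) j = -monomialValue F i (j + 1) := by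
  rw [eq_neg_iff_add_eq_zero, monomialValue, monomialValue, ← lineValue_add hF,
    ← lineValue_add_mul hnat hF (contDiff_monomial i j 1)]
  congr 1
  funext p
  ring

theorem monomialValue_eq (hnat : IsFunctorial F) (hF : ∀ E, SemiHol.IsMorphism (F E) (b E))
    (i j : ℕ) : monomialValue F i j = (-1) ^ i * monomialValue F 0 (i + j) := by
  induction i generalizing j with
  | zero => simp
  | succ i ih =>
    rw [monomialValue_succ hnat hF, ih, show i + (j + 1) = i + 1 + j by omega]
    ring

theorem monomialValue_eq_zero (hF : ∀ E, SemiHol.IsMorphism (F E) (b E)) {l : ℕ} (hl : k < l) :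
    monomialValue F 0 l = 0 := by
  rw [← lineValue_zero (V := ℝ) hF, monomialValue]
  refine lineValue_congr _ _ fun α _ β hβ => ?_
  -- The zero function is treated as a monomial with coefficient $0$.
  have h := mixedDeriv_monomial 0 0 α β 0
  simp only [zero_mul, ite_self] at h
  rw [h, mixedDeriv_monomial, if_neg (by omega)]

/-- $g$ may be replaced by its Taylor polynomial of order $(k,k)$, and the value is linear in $g$.
-/
theorem lineValue_eq_sum_monomialValue (hF : ∀ E, SemiHol.IsMorphism (F E) (b E))
    {g : ℝ × ℝ → ℝ} (hg : ContDiff ℝ ∞ g) :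
    lineValue F g hg = ∑ α ∈ Finset.range (k + 1), ∑ β ∈ Finset.range (k + 1),
      mixedDeriv α β g / (α.factorial * β.factorial) * monomialValue F α β := by
  set a : ℕ × ℕ → ℝ := fun q => mixedDeriv q.1 q.2 g / (q.1.factorial * q.2.factorial)
  set s := Finset.range (k + 1) ×ˢ Finset.range (k + 1)
  have hm : ∀ q : ℕ × ℕ, ContDiff ℝ ∞ (fun p : ℝ × ℝ => a q * (p.1 ^ q.1 * p.2 ^ q.2)) :=
    fun q => contDiff_monomial q.1 q.2 (a q)
  have h1 : lineValue F g hg = lineValue F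
      (fun p => ∑ q ∈ s, a q * (p.1 ^ q.1 * p.2 ^ q.2)) (ContDiff.sum fun q _ => hm q) := by
    refine lineValue_congr _ _ fun α hα β hβ => ?_
    rw [mixedDeriv_sum s α β fun q _ => hm q, Finset.sum_eq_single (α, β)]
    · rw [mixedDeriv_monomial, if_pos ⟨rfl, rfl⟩]
      have h2 : (α.factorial : ℝ) ≠ 0 := by exact_mod_cast α.factorial_ne_zero
      have h3 : (β.factorial : ℝ) ≠ 0 := by exact_mod_cast β.factorial_ne_zero
      simp only [a]
      field_simp
    · intro q _ hq
      rw [mixedDeriv_monomial, if_neg]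
      rintro ⟨rfl, rfl⟩
      exact hq rfl
    · intro h
      exact absurd (Finset.mem_product.2
        ⟨Finset.mem_range.2 (Nat.lt_succ_of_le hα), Finset.mem_range.2 (Nat.lt_succ_of_le hβ)⟩) h
  rw [h1, lineValue_sum hF s hm, ← Finset.sum_product']
  refine Finset.sum_congr rfl fun q _ => ?_
  have h2 := lineValue_smul hF (a q) (contDiff_monomial q.1 q.2 1)
  simp only [one_mul, smul_eq_mul] at h2
  simp only [monomialValue, one_mul]
  exact h2

/-- Terms of the square with $\alpha+\beta>k$ vanish; the remaining triangle is summed along the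
antidiagonals $\alpha+\beta=l$, where $1/(\alpha!\,\beta!)=\binom{l}{\alpha}/l!$. -/
theorem sum_square_eq_sum_choose (k : ℕ) (d : ℕ → ℕ → ℝ) (m : ℕ → ℝ) (hm : ∀ l, k < l → m l = 0) :
    ∑ α ∈ Finset.range (k + 1), ∑ β ∈ Finset.range (k + 1),
        d α β / (α.factorial * β.factorial) * ((-1) ^ α * m (α + β)) =
      ∑ l ∈ Finset.range (k + 1), m l / l.factorial *
        ∑ α ∈ Finset.range (l + 1), ((-1) ^ α * (l.choose α : ℝ)) * d α (l - α) := by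
  set f : ℕ → ℕ → ℝ := fun α β =>
    d α β / (α.factorial * β.factorial) * ((-1) ^ α * m (α + β)) with hf
  have h1 : ∑ α ∈ Finset.range (k + 1), ∑ β ∈ Finset.range (k + 1), f α β =
      ∑ α ∈ Finset.range (k + 1), ∑ β ∈ Finset.range (k + 1 - α), f α β := by
    refine Finset.sum_congr rfl fun α _ => (Finset.sum_subset
      (Finset.range_subset_range.2 (Nat.sub_le _ _)) fun β _ hβ => ?_).symm
    rw [Finset.mem_range, not_lt] at hβ
    rw [hf]
    simp [hm (α + β) (by omega)]
  rw [h1, ← Finset.sum_range_diag_flip]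
  refine Finset.sum_congr rfl fun l _ => ?_
  rw [Finset.mul_sum]
  refine Finset.sum_congr rfl fun α hα => ?_
  have hl : α ≤ l := Nat.lt_succ_iff.1 (Finset.mem_range.1 hα)
  have h2 : (l.factorial : ℝ) ≠ 0 := by exact_mod_cast l.factorial_ne_zero
  simp only [hf]
  rw [Nat.add_sub_cancel' hl, Nat.cast_choose ℝ hl]
  field_simp

/-- The alternating sum of mixed derivatives which defines `Υ_l`. -/
def alternatingSum (l : ℕ) (g : ℝ × ℝ → V) : V :=
  ∑ α ∈ Finset.range (l + 1), ((-1 : ℝ) ^ α * (l.choose α : ℝ)) • mixedDeriv α (l - α) g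

/-- The constants of a functorial morphism. -/
def functorialCoeff (F : ∀ E : VB, SemiHol k E → E.Total) (l : ℕ) : ℝ :=
  monomialValue F 0 l / l.factorial

theorem lineValue_eq (hnat : IsFunctorial F) (hF : ∀ E, SemiHol.IsMorphism (F E) (b E))
    {g : ℝ × ℝ → V} (hg : ContDiff ℝ ∞ g) :
    lineValue F g hg =
      ∑ l : Fin (k + 1), functorialCoeff F l • alternatingSum (l : ℕ) g := by
  rw [Fin.sum_univ_eq_sum_range (fun l => functorialCoeff F l • alternatingSum l g),
    SeparatingDual.eq_iff_forall_dual_eq (R := ℝ)]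
  intro φ
  rw [← lineValue_linear hnat φ hg, lineValue_eq_sum_monomialValue hF]
  refine (Finset.sum_congr rfl fun α _ => Finset.sum_congr rfl fun β _ => by
    rw [monomialValue_eq hnat hF α β]).trans ?_
  simp only [map_sum, map_smul, alternatingSum,
    mixedDeriv_clm_comp _ _ φ hg, smul_eq_mul]
  exact sum_square_eq_sum_choose k (fun α β => φ (mixedDeriv α β g)) _
    fun l hl => monomialValue_eq_zero hF hl

/-- The preferred trivialization at the base point undoes the morphism, so the fibre coordinates of
the image are the mixed derivatives of $g$. -/
theorem upsilon_truncate_map_lineVector {E : VB} (c : Curve (𝓡 E.n) E.M)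
    (hc : ∀ t, c t ∈ (trivializationAt E.F E.fiber (c 0)).baseSet) {g : ℝ × ℝ → E.F}
    (hg : ContDiff ℝ ∞ g) {l : ℕ} (hl : l ≤ k) :
    upsilon l (((lineVector k g hg).map (trivHom (c 0) c hc)).truncate hl) =
      (trivHom (c 0) c hc).total (linePoint (lineCurve 0) (alternatingSum l g)) := by
  set γ : Surface E.model E.Total := (trivHom (c 0) c hc).total.comp (lineSurface g hg) with hγ
  have h0 : (γ 0).proj = c 0 := by
    change c (ofLine (toLine (0 + 0))) = c 0
    simp
  have h1 : ∀ α β, fiberCoord α β γ = mixedDeriv α β g := by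
    intro α β
    rw [fiberCoord, h0]
    congr 1
    funext p
    exact congrArg Prod.snd (trivHom_total (c 0) c hc (toLine (p.1 + p.2)) (g p))
  -- Stated for variable `r` and `x` so that substitution can replace the base points, on which the
  -- types of the fibre vectors depend.
  have h2 : ∀ r : ℝ, r = 0 → ∀ x, x = c 0 →
      (⟨x, (trivializationAt E.F E.fiber x).symm x (alternatingSum l g)⟩ : E.Total) =
        ⟨c r, (trivializationAt E.F E.fiber (c 0)).symmₗ ℝ (c r) (alternatingSum l g)⟩ := by
    rintro r rfl x rfl
    rw [Trivialization.symmₗ_apply _ (hc 0)]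
  change upsilonAux l γ = _
  rw [upsilonAux]
  simp only [h1]
  exact h2 (ofLine (toLine 0)) (ofLine_toLine 0) _ h0

end Functorial

end HigherTangent

end

theorem mainTheorem2 (k : ℕ)
    (F : ∀ E : HigherTangent.VB, HigherTangent.SemiHol k E → E.Total)
    (b : ∀ E : HigherTangent.VB, HigherTangent.TT (𝓡 E.n) E.M (k + k) → E.M)
    (hF : ∀ E, HigherTangent.SemiHol.IsMorphism (F E) (b E))
    (hnat : ∀ (E₁ E₂ : HigherTangent.VB) (f : HigherTangent.VBHom E₁ E₂)
      (Φ : HigherTangent.SemiHol k E₁), F E₂ (Φ.map f) = f.total (F E₁ Φ)) :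
    (∀ E : HigherTangent.VB, ConnectedSpace E.M → ∀ v, b E v = v.proj) ∧
    ∃ a : Fin (k + 1) → ℝ, ∀ E : HigherTangent.VB, ConnectedSpace E.M →
      ∀ Φ : HigherTangent.SemiHol k E,
        ∃ w : Fin (k + 1) → E.fiber Φ.base.proj,
          (∀ l : Fin (k + 1),
            HigherTangent.upsilon (l : ℕ) (Φ.truncate l.is_le) = ⟨Φ.base.proj, w l⟩) ∧
          F E Φ = ⟨Φ.base.proj, ∑ l, a l • w l⟩ := by
  have hfun : HigherTangent.IsFunctorial F := hnat
  refine ⟨fun E _ => hfun.base_eq_proj hF E,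
    fun l => HigherTangent.functorialCoeff F l, fun E _ Φ => ?_⟩
  obtain ⟨c, hc, g, hg, rfl⟩ := Φ.exists_eq_map_lineVector
  -- Both $F$ and the $\Upsilon_l$ arise by applying this one fibre map to values on the line, so
  -- its linearity carries the formula over to $E$.
  let L : E.F →ₗ[ℝ] E.fiber (HigherTangent.curveMap c (HigherTangent.lineCurve 0)) :=
    (HigherTangent.trivHom (c 0) c hc).onFiber (HigherTangent.lineCurve 0)
  refine ⟨fun l => L (HigherTangent.alternatingSum (l : ℕ) g),
    fun l => HigherTangent.upsilon_truncate_map_lineVector c hc hg l.is_le, ?_⟩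
  rw [hnat, hfun.apply_lineVector hF, HigherTangent.lineValue_eq hfun hF]
  have hL : L (∑ l : Fin (k + 1), HigherTangent.functorialCoeff F l •
      HigherTangent.alternatingSum (l : ℕ) g) = ∑ l : Fin (k + 1),
        HigherTangent.functorialCoeff F l • L (HigherTangent.alternatingSum (l : ℕ) g) := by
    simp only [map_sum, map_smul]
  exact congrArg (TotalSpace.mk (HigherTangent.curveMap c (HigherTangent.lineCurve 0))) hL
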